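/- Let $X$ and $Y$ be real Fr\'echet spaces (locally convex spaces whose topology is generated by a complete translation-invariant metric), and let $(P_k)_{k\in\mathbb N}$ and $(Q_k)_{k\in\mathbb N}$ be sequences of continuous linear operators of finite rank on $X$ and on $Y$ with $P_kx\to x$ for all $x\in X$ and $Q_ky\to y$ for all $y\in Y$. Let $c:X\times Y\to[0,+\infty]$ be lower semicontinuous. Suppose that for every $k$ the restriction of $c$ to $P_k[X]\times Q_k[Y]$ is locally coercive: for every bounded $V\subset P_k[X]$ and all $\epsilon>0$, $M>0$ there is a bounded $W\subset Q_k[Y]$ such that $x\in V$, $y\in Q_k[Y]$ and $$c(x,y)<\min\Big\{\sup_{\eta\in Q_k[Y]}c(x,\eta)-\epsilon,\;M\Big\}$$ imply $y\in W$. Assume moreover that $c(P_kx,Q_ky)\le c(x,y)$ for all $k\in\mathbb N$, $x\in X$ and $y\in Y$. For Borel probability measures $\mu$ on $X$ and $\nu$ on $Y$ let $\mathscr C_c(\mu,\nu)=\inf_\gamma\int_{X\times Y}c\,d\gamma\in[0,+\infty]$, where $\gamma$ runs over the measures on $X\times Y$ with marginals $\mu$ and $\nu$. For $\delta>0$ let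 $\Phi_c^\delta$ be the set of pairs $(\varphi,\psi)$ of bounded continuous functions $\varphi:X\to\mathbb R$, $\psi:Y\to\mathbb R$ such that $\varphi(x)+\psi(y)\le c(x,y)$ for $\mu$-almost every $x$ and $\nu$-almost every $y$ (that is, for all $x\notin N$ and $y\notin N'$, for some $\mu$-null set $N\subset X$ and $\nu$-null set $N'\subset Y$), and $$-\delta\le\inf_X\varphi\le0,\qquad \sup_X\varphi\le\sup_{X\times Y}c,\qquad \psi\ge-\sup_X\varphi-\delta,\qquad \sup_Y\psi\ge-\delta.$$ For a continuous finite rank operator $P$ on $X$, let $\mathrm{Cyl}(X;P)$ be the set of functions $f\circ\iota\circ P$ with $f\in C_c^\infty(\mathbb R^n)$, where $n=\dim P[X]$ and $\iota:P[X]\to\mathbb R^n$ is a linear isomorphism; similarly for $Y$. Then, for all such $\mu$, $\nu$ and all $\delta>0$, $$\mathscr C_c(\mu,\nu)=\sup\Big\{\int_X\varphi\,d\mu+\int_Y\psi\,d\nu:\ k\in\mathbb N,\ (\varphi,\psi)\in\Phi_c^\delta\cap\big(\mathrm{Cyl}(X;P_k)\times\mathrm{Cyl}(Y;Q_k)\big)\Big\}.$$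 -/

import Mathlib

open MeasureTheory Filter Topology
open scoped ENNReal NNReal

noncomputable section

namespace CylOT

/-- `Γ(μ, ν)`: the measures on the product with marginals `μ` and `ν`. -/
def couplings {X Y : Type*} [MeasurableSpace X] [MeasurableSpace Y]
    (μ : Measure X) (ν : Measure Y) : Set (Measure (X × Y)) :=
  {γ | γ.map Prod.fst = μ ∧ γ.map Prod.snd = ν}

/-- The Monge-Kantorovich cost: the infimum of `∫ c dγ` over all couplings `γ`. -/
def transportCost {X Y : Type*} [MeasurableSpace X] [MeasurableSpace Y]
    (c : X × Y → ℝ≥0∞) (μ : Measure X) (ν : Measure Y) : ℝ≥0∞ :=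
  ⨅ γ ∈ couplings μ ν, ∫⁻ p, c p ∂γ

/-- `Φ_c`: the pairs of integrable functions such that `φ x + ψ y ≤ c (x, y)` for `μ`-almost every
`x` and `ν`-almost every `y`, that is, for all `x` and `y` outside a `μ`-null set of points `x` and
a `ν`-null set of points `y`. -/
def dualPairs {X Y : Type*} [MeasurableSpace X] [MeasurableSpace Y]
    (c : X × Y → ℝ≥0∞) (μ : Measure X) (ν : Measure Y) : Set ((X → ℝ) × (Y → ℝ)) :=
  {p | Integrable p.1 μ ∧ Integrable p.2 ν ∧
    ∃ A : Set X, ∃ B : Set Y, μ Aᶜ = 0 ∧ ν Bᶜ = 0 ∧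
      ∀ x ∈ A, ∀ y ∈ B, ((p.1 x + p.2 y : ℝ) : EReal) ≤ (c (x, y) : EReal)}

/-- `C⁰_b(X)`: the bounded continuous real functions. -/
def boundedContinuous (X : Type*) [TopologicalSpace X] : Set (X → ℝ) :=
  {f | Continuous f ∧ ∃ C : ℝ, ∀ x, |f x| ≤ C}

/-- `Φ_c^δ`: the pairs in `Φ_c ∩ (C⁰_b(X) × C⁰_b(Y))` that satisfy the relaxed bounds. The real
suprema and infima are those of bounded functions. -/
def relaxedDualPairs {X Y : Type*} [TopologicalSpace X] [MeasurableSpace X]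
    [TopologicalSpace Y] [MeasurableSpace Y]
    (c : X × Y → ℝ≥0∞) (μ : Measure X) (ν : Measure Y) (δ : ℝ) : Set ((X → ℝ) × (Y → ℝ)) :=
  {p | p ∈ dualPairs c μ ν ∧ p.1 ∈ boundedContinuous X ∧ p.2 ∈ boundedContinuous Y ∧
    -δ ≤ (⨅ x, p.1 x) ∧ (⨅ x, p.1 x) ≤ 0 ∧
    (((⨆ x, p.1 x : ℝ)) : EReal) ≤ (((⨆ q, c q : ℝ≥0∞)) : EReal) ∧
    (∀ y, -(⨆ x, p.1 x) - δ ≤ p.2 y) ∧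
    -δ ≤ (⨆ y, p.2 y)}

/-- `Cyl(X; P)`: the functions `φ ∘ ι ∘ P` with `φ` smooth and compactly supported on `ℝⁿ`, where
`ι` identifies the range of `P` with `ℝⁿ`. The class does not depend on `ι`. -/
def cylindrical {X : Type*} [AddCommGroup X] [Module ℝ X] [TopologicalSpace X]
    (P : X →L[ℝ] X) : Set (X → ℝ) :=
  {f | ∃ (ι : LinearMap.range P.toLinearMap ≃L[ℝ]
        EuclideanSpace ℝ (Fin (Module.finrank ℝ (LinearMap.range P.toLinearMap))))
      (φ : EuclideanSpace ℝ (Fin (Module.finrank ℝ (LinearMap.range P.toLinearMap))) → ℝ),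
      ContDiff ℝ (⊤ : ℕ∞) φ ∧ HasCompactSupport φ ∧
      ∀ x, f x = φ (ι ⟨P x, x, rfl⟩)}

/-- The restriction of a cost to `P[X] × Q[Y]`. -/
def restrictCost {X Y : Type*} [AddCommGroup X] [Module ℝ X] [TopologicalSpace X]
    [AddCommGroup Y] [Module ℝ Y] [TopologicalSpace Y]
    (c : X × Y → ℝ≥0∞) (P : X →L[ℝ] X) (Q : Y →L[ℝ] Y) :
    LinearMap.range P.toLinearMap × LinearMap.range Q.toLinearMap → ℝ≥0∞ :=
  fun p => c (p.1, p.2)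

/-- Local coercivity of a cost: for `x` in a bounded set, `c (x, y)` can stay below
`min (sup_η c (x, η) - δ) M` only for `y` in a bounded set. The subtraction is truncated, which
changes nothing: where `sup_η c (x, η) ≤ δ`, no `y` satisfies the inequality, with or without
truncation. -/
def LocallyCoercive {E F : Type*} [AddCommGroup E] [Module ℝ E] [TopologicalSpace E]
    [AddCommGroup F] [Module ℝ F] [TopologicalSpace F] (c : E × F → ℝ≥0∞) : Prop :=
  ∀ V : Set E, Bornology.IsVonNBounded ℝ V → ∀ δ : ℝ≥0, 0 < δ → ∀ M : ℝ≥0, 0 < M →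
    ∃ W : Set F, Bornology.IsVonNBounded ℝ W ∧
      ∀ x ∈ V, ∀ y : F, c (x, y) < min ((⨆ η : F, c (x, η)) - (δ : ℝ≥0∞)) (M : ℝ≥0∞) → y ∈ W

end CylOT

end

/-! One inequality is weak duality: integrate `φ ⊕ ψ ≤ c` against any coupling. The other combines
two facts.

Kantorovich duality for lower semicontinuous costs (`exists_coupling_lintegral_le`). The spaces are
Polish, so they embed in Hilbert cubes `K` and `L`. If `D` bounds all bounded continuous dual
values, the M. Riesz extension theorem gives a positive functional on `C(K × L)` with the prescribed
marginals and with value at most `D` on every function below `c`. Its representing measure has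
marginals carried by the images of `X` and `Y`, so it pulls back to a coupling; compactness of `K ×
L` replaces tightness. Since `c` is an increasing limit of continuous functions on `K × L`, this
coupling costs at most `D`.

Approximation (`exists_cylindrical_pair`). A bounded continuous pair restricted to `P_k[X] × Q_k[Y]`
is a finite-dimensional object. There it is normalized, cut off at infinity by local coercivity, and
smoothed from below; the slack `δ` pays for the smoothing. Composed with `P_k` and `Q_k` the result
stays admissible because `c (P_k x, Q_k y) ≤ c (x, y)`. Up to `ε` its value is at least `∫ φ ∘ P_k
dμ + ∫ ψ ∘ Q_k dν`, which tends to `∫ φ dμ + ∫ ψ dν`. Hence the cylindrical supremum can serve as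
`D`. -/

namespace CylOT

open BoundedContinuousFunction

/-! ### Lower semicontinuous costs as limits of continuous functions -/

/-- A lower semicontinuous function on a subspace is the supremum of an increasing sequence of
continuous functions on the ambient space. -/
theorem exists_monotone_continuousMap_iSup_eq {T K : Type*} [TopologicalSpace T]
    [SecondCountableTopology T] [TopologicalSpace K] [NormalSpace K] [T1Space K]
    {e : T → K} (he : IsEmbedding e) {c : T → ℝ≥0∞} (hc : LowerSemicontinuous c) :
    ∃ v : ℕ → C(K, ℝ), Monotone v ∧ (∀ n, 0 ≤ v n) ∧
      ∀ w, ⨆ n, ENNReal.ofReal (v n (e w)) = c w := by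
  let good : Set C(K, ℝ) := {u | 0 ≤ u ∧ ∀ w, ENNReal.ofReal (u (e w)) ≤ c w}
  let F : Set (T → ℝ≥0∞) := {f | ∃ u ∈ good, f = fun w => ENNReal.ofReal (u (e w))}
  have hlub : IsLUB F c := by
    refine ⟨?_, fun b hb z => ?_⟩
    · rintro _ ⟨u, hu, rfl⟩ w
      exact hu.2 w
    -- For `a < c z`, `a` times a Urysohn function at `e z`, supported where `c > a`, lies in the
    -- family and equals `a` at `z`.
    · refine ENNReal.le_of_forall_nnreal_lt fun a ha => ?_
      obtain ⟨U, hU, hUc⟩ := he.isOpen_iff.1 (hc.isOpen_preimage (a : ℝ≥0∞))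
      have hz : e z ∈ U := by
        change z ∈ e ⁻¹' U
        rw [hUc]; exact ha
      obtain ⟨f, hf0, hf1, hf⟩ := exists_continuous_zero_one_of_isClosed
        (s := Uᶜ) (t := {e z}) hU.isClosed_compl isClosed_singleton
        (by simpa [Set.disjoint_singleton_right] using hz)
      have hmem : (a : ℝ) • f ∈ good := by
        refine ⟨fun x => ?_, fun w => ?_⟩
        · exact mul_nonneg a.2 (hf x).1
        · by_cases hw : e w ∈ U
          · have : (a : ℝ≥0∞) < c w := by
              have : w ∈ e ⁻¹' U := hw
              rw [hUc] at this; exact this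
            refine le_trans ?_ this.le
            rw [← ENNReal.ofReal_coe_nnreal]
            exact ENNReal.ofReal_le_ofReal (mul_le_of_le_one_right a.2 (hf _).2)
          · simp [hf0 hw]
      have := hb ⟨_, hmem, rfl⟩ z
      simpa [hf1 (Set.mem_singleton (e z))] using this
  obtain ⟨F', hF'F, hF'c, hF'⟩ := exists_countable_lowerSemicontinuous_isLUB (by
    rintro _ ⟨u, -, rfl⟩
    exact (ENNReal.continuous_ofReal.comp (u.continuous.comp he.continuous)).lowerSemicontinuous)
    hlub
  -- Adjoining zero makes the countable subfamily nonempty, so that a sequence enumerates it.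
  have hzero : (fun _ => 0 : T → ℝ≥0∞) ∈ F := ⟨0, ⟨le_rfl, by simp⟩, by simp⟩
  obtain ⟨f, hf⟩ := (hF'c.insert (fun _ => 0 : T → ℝ≥0∞)).exists_eq_range
    (Set.insert_nonempty _ _)
  have hfF : ∀ n, f n ∈ F := fun n => by
    have : f n ∈ insert (fun _ => 0 : T → ℝ≥0∞) F' := hf ▸ Set.mem_range_self n
    rcases this with h | h
    · rw [h]; exact hzero
    · exact hF'F h
  choose u hu hfu using hfF
  have hsup : ∀ n w, ENNReal.ofReal (partialSups u n (e w)) ≤ c w := fun n w =>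
    (partialSups_iff_forall (f := u) (i := n)
      (fun g : C(K, ℝ) => ENNReal.ofReal (g (e w)) ≤ c w) (fun {a b} => by
        simp [ContinuousMap.sup_apply, ENNReal.ofReal_max])).2 fun j _ => (hu j).2 w
  refine ⟨partialSups u, (partialSups u).monotone,
    fun n => (hu n).1.trans (le_partialSups u n), fun w => le_antisymm (iSup_le fun n => hsup n w) ?_⟩
  have : c ≤ fun w => ⨆ n, ENNReal.ofReal (partialSups u n (e w)) := by
    refine hF'.2 fun g hg w => ?_
    have : g ∈ Set.range f := hf ▸ Set.mem_insert_of_mem _ hg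
    obtain ⟨n, rfl⟩ := this
    rw [hfu n]
    exact le_iSup_of_le n (ENNReal.ofReal_le_ofReal (le_partialSups u n (e w)))
  exact this w

/-! ### Kantorovich duality by Riesz extension -/

section Duality

variable {X Y K L : Type*} [TopologicalSpace X] [TopologicalSpace Y] [TopologicalSpace K]
  [TopologicalSpace L]

/-- The cone of tuples `(φ, ψ, t, u)` with `0 ≤ t` and `0 ≤ φ ⊕ ψ + t c + u ∘ (i × j)`. -/
def dualCone (c : X × Y → ℝ≥0∞) (i : X → K) (j : Y → L) :
    PointedCone ℝ ((X →ᵇ ℝ) × (Y →ᵇ ℝ) × ℝ × C(K × L, ℝ)) where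
  -- Only the negative part is compared with `t c`, so infinite costs are allowed. By `0 * ∞ = 0`,
  -- `t = 0` forces `φ ⊕ ψ + u ∘ (i × j) ≥ 0` even where `c = ∞`.
  carrier := {p | 0 ≤ p.2.2.1 ∧ ∀ x y,
    ENNReal.ofReal (-(p.1 x + p.2.1 y + p.2.2.2 (i x, j y))) ≤ ENNReal.ofReal p.2.2.1 * c (x, y)}
  zero_mem' := by simp
  add_mem' := by
    rintro ⟨φ, ψ, t, u⟩ ⟨φ', ψ', t', u'⟩ ⟨ht, h⟩ ⟨ht', h'⟩
    refine ⟨add_nonneg ht ht', fun x y => ?_⟩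
    have := add_le_add (h x y) (h' x y)
    simp only [Prod.mk_add_mk, BoundedContinuousFunction.coe_add, Pi.add_apply,
      ContinuousMap.add_apply] at this ⊢
    rw [ENNReal.ofReal_add ht ht', add_mul]
    refine le_trans (le_trans (le_of_eq ?_) ENNReal.ofReal_add_le) this
    congr 1; ring
  smul_mem' := by
    rintro a ⟨φ, ψ, t, u⟩ ⟨ht, h⟩
    refine ⟨mul_nonneg a.2 ht, fun x y => ?_⟩
    have := mul_le_mul_right (h x y) (ENNReal.ofReal a)
    rw [← ENNReal.ofReal_mul a.2, ← mul_assoc, ← ENNReal.ofReal_mul a.2] at this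
    refine le_trans (le_of_eq ?_) this
    congr 1
    change -((a : ℝ) * φ x + (a : ℝ) * ψ y + (a : ℝ) * u (i x, j y)) = _
    ring

theorem mem_dualCone {c : X × Y → ℝ≥0∞} {i : X → K} {j : Y → L}
    {p : (X →ᵇ ℝ) × (Y →ᵇ ℝ) × ℝ × C(K × L, ℝ)} :
    p ∈ dualCone c i j ↔ 0 ≤ p.2.2.1 ∧ ∀ x y,
      ENNReal.ofReal (-(p.1 x + p.2.1 y + p.2.2.2 (i x, j y))) ≤
        ENNReal.ofReal p.2.2.1 * c (x, y) := Iff.rfl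

variable [MeasurableSpace X] [OpensMeasurableSpace X] [MeasurableSpace Y] [OpensMeasurableSpace Y]

/-- The functional `(φ, ψ, t, u) ↦ ∫ φ dμ + ∫ ψ dν + t D`. -/
noncomputable def dualFunctional (L K : Type*) [TopologicalSpace K] [TopologicalSpace L]
    (μ : Measure X) [IsFiniteMeasure μ] (ν : Measure Y) [IsFiniteMeasure ν] (D : ℝ) :
    ((X →ᵇ ℝ) × (Y →ᵇ ℝ) × ℝ × C(K × L, ℝ)) →ₗ[ℝ] ℝ where
  toFun p := ∫ x, p.1 x ∂μ + ∫ y, p.2.1 y ∂ν + p.2.2.1 * D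
  map_add' p q := by
    have h1 := integral_add (p.1.integrable μ) (q.1.integrable μ)
    have h2 := integral_add (p.2.1.integrable ν) (q.2.1.integrable ν)
    simp only [Prod.fst_add, Prod.snd_add, BoundedContinuousFunction.coe_add, Pi.add_apply, h1, h2]
    ring
  map_smul' a p := by
    simp only [Prod.smul_fst, Prod.smul_snd, BoundedContinuousFunction.coe_smul, smul_eq_mul,
      integral_const_mul, RingHom.id_apply]
    ring

-- For every `s > t`, the pair `(-φ / s, -ψ / s)` is dual admissible, so its value is at most `D`.
-- Letting `s` decrease to `t` also covers `t = 0`, where division is impossible.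
omit [OpensMeasurableSpace X] [OpensMeasurableSpace Y] in
theorem dualFunctional_nonneg {μ : Measure X} [IsFiniteMeasure μ] {ν : Measure Y}
    [IsFiniteMeasure ν] {c : X × Y → ℝ≥0∞} {D : ℝ} {i : X → K} {j : Y → L}
    (h : ∀ (φ : X →ᵇ ℝ) (ψ : Y →ᵇ ℝ), (∀ x y, ENNReal.ofReal (φ x + ψ y) ≤ c (x, y)) →
      ∫ x, φ x ∂μ + ∫ y, ψ y ∂ν ≤ D)
    (φ : X →ᵇ ℝ) (ψ : Y →ᵇ ℝ) (t : ℝ) (hp : (φ, ψ, t, (0 : C(K × L, ℝ))) ∈ dualCone c i j) :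
    0 ≤ ∫ x, φ x ∂μ + ∫ y, ψ y ∂ν + t * D := by
  obtain ⟨ht, hp⟩ := mem_dualCone.1 hp
  simp only [ContinuousMap.zero_apply, add_zero] at ht hp
  have key : ∀ s > t, 0 ≤ ∫ x, φ x ∂μ + ∫ y, ψ y ∂ν + s * D := by
    intro s hs
    have hs0 : 0 < s := ht.trans_lt hs
    have := h ((-s⁻¹) • φ) ((-s⁻¹) • ψ) fun x y => by
      have h1 : ENNReal.ofReal (-(φ x + ψ y)) ≤ ENNReal.ofReal s * c (x, y) :=
        (hp x y).trans (mul_le_mul_left (ENNReal.ofReal_le_ofReal hs.le) _)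
      have h2 := mul_le_mul_right h1 (ENNReal.ofReal s⁻¹)
      rw [← ENNReal.ofReal_mul (inv_nonneg.2 hs0.le), ← mul_assoc,
        ← ENNReal.ofReal_mul (inv_nonneg.2 hs0.le), inv_mul_cancel₀ hs0.ne', ENNReal.ofReal_one,
        one_mul] at h2
      refine le_trans (le_of_eq ?_) h2
      congr 1
      simp only [BoundedContinuousFunction.coe_smul, smul_eq_mul]
      ring
    simp only [BoundedContinuousFunction.coe_smul, smul_eq_mul, integral_const_mul] at this
    have h3 := mul_le_mul_of_nonneg_left this hs0.le
    have h4 : s * s⁻¹ = 1 := mul_inv_cancel₀ hs0.ne'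
    have h5 : s * (-s⁻¹ * ∫ x, φ x ∂μ + -s⁻¹ * ∫ y, ψ y ∂ν) =
        -(s * s⁻¹) * (∫ x, φ x ∂μ + ∫ y, ψ y ∂ν) := by ring
    rw [h5, h4] at h3
    linarith
  have hcont : Tendsto (fun s => ∫ x, φ x ∂μ + ∫ y, ψ y ∂ν + s * D) (𝓝[>] t)
      (𝓝 (∫ x, φ x ∂μ + ∫ y, ψ y ∂ν + t * D)) :=
    ((continuous_const.add (continuous_id.mul continuous_const)).tendsto t).mono_left
      nhdsWithin_le_nhds
  exact ge_of_tendsto hcont (eventually_mem_nhdsWithin.mono fun s hs => key s hs)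

variable [CompactSpace K] [CompactSpace L]

/-- The positive functional on the compactification produced by the Riesz extension theorem. -/
theorem exists_functional_of_dual_le {μ : Measure X} [IsFiniteMeasure μ] {ν : Measure Y}
    [IsFiniteMeasure ν] {c : X × Y → ℝ≥0∞} {D : ℝ} (i : X → K) (j : Y → L)
    (h : ∀ (φ : X →ᵇ ℝ) (ψ : Y →ᵇ ℝ), (∀ x y, ENNReal.ofReal (φ x + ψ y) ≤ c (x, y)) →
      ∫ x, φ x ∂μ + ∫ y, ψ y ∂ν ≤ D) :
    ∃ Λ : C(K × L, ℝ) →ₗ[ℝ] ℝ, (∀ u, 0 ≤ u → 0 ≤ Λ u) ∧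
      (∀ u : C(K × L, ℝ), (∀ x y, ENNReal.ofReal (u (i x, j y)) ≤ c (x, y)) → Λ u ≤ D) ∧
      (∀ (u : C(K × L, ℝ)) (φ : X →ᵇ ℝ), (∀ x y, u (i x, j y) = φ x) → Λ u = ∫ x, φ x ∂μ) ∧
      (∀ (u : C(K × L, ℝ)) (ψ : Y →ᵇ ℝ), (∀ x y, u (i x, j y) = ψ y) → Λ u = ∫ y, ψ y ∂ν) := by
  let V := (X →ᵇ ℝ) × (Y →ᵇ ℝ) × ℝ × C(K × L, ℝ)
  let S : Submodule ℝ V := (⊤ : Submodule ℝ (X →ᵇ ℝ)).prod ((⊤ : Submodule ℝ (Y →ᵇ ℝ)).prod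
    ((⊤ : Submodule ℝ ℝ).prod (⊥ : Submodule ℝ C(K × L, ℝ))))
  let f : V →ₗ.[ℝ] ℝ := ⟨S, (dualFunctional L K μ ν D).domRestrict S⟩
  have hS : ∀ φ ψ t, ((φ, ψ, t, 0) : V) ∈ S := fun φ ψ t =>
    ⟨trivial, trivial, trivial, rfl⟩
  obtain ⟨g, hg, hgs⟩ := riesz_extension (dualCone c i j) f (by
    rintro ⟨⟨φ, ψ, t, u⟩, hu⟩ hp
    obtain rfl : u = 0 := by simpa [f, S] using hu
    exact dualFunctional_nonneg h φ ψ t hp) (by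
    rintro ⟨φ, ψ, t, u⟩
    -- Added to the given vector, this leaves `‖u‖ + u ≥ 0` with `t = 0`.
    refine ⟨⟨(BoundedContinuousFunction.const X ‖u‖ - φ, -ψ, -t, 0), hS _ _ _⟩, ?_⟩
    rw [mem_dualCone]
    refine ⟨by simp, fun x y => ?_⟩
    have := (abs_le.1 (u.norm_coe_le_norm (i x, j y))).1
    rw [ENNReal.ofReal_of_nonpos]
    · simp
    · simp; linarith)
  have hg' : ∀ φ ψ t, g (φ, ψ, t, 0) = ∫ x, φ x ∂μ + ∫ y, ψ y ∂ν + t * D :=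
    fun φ ψ t => hg ⟨(φ, ψ, t, 0), hS φ ψ t⟩
  have split : ∀ φ ψ t u, g (φ, ψ, t, u) = ∫ x, φ x ∂μ + ∫ y, ψ y ∂ν + t * D + g (0, 0, 0, u) :=
    fun φ ψ t u => by rw [← hg', ← map_add]; simp
  -- When `u` pulls back to `φ ⊕ ψ`, both `(-φ, -ψ, 0, u)` and its negative lie in the cone, so
  -- positivity gives equality.
  have eq_of : ∀ (φ : X →ᵇ ℝ) (ψ : Y →ᵇ ℝ) (u : C(K × L, ℝ)), (∀ x y, u (i x, j y) = φ x + ψ y) →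
      g (0, 0, 0, u) = ∫ x, φ x ∂μ + ∫ y, ψ y ∂ν := by
    intro φ ψ u hu
    have h1 := hgs (-φ, -ψ, 0, u) ⟨le_rfl, fun x y => by simp [hu]; linarith⟩
    have h2 := hgs (φ, ψ, 0, -u) ⟨le_rfl, fun x y => by simp [hu]⟩
    rw [split] at h1 h2
    have h3 : g (0, 0, 0, -u) = - g (0, 0, 0, u) := by rw [← map_neg]; simp
    simp only [BoundedContinuousFunction.coe_neg, Pi.neg_apply, integral_neg] at h1
    linarith
  refine ⟨g ∘ₗ LinearMap.inr ℝ _ _ ∘ₗ LinearMap.inr ℝ _ _ ∘ₗ LinearMap.inr ℝ _ _,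
    fun u hu => ?_, fun u hu => ?_, fun u φ hu => ?_, fun u ψ hu => ?_⟩
  · refine hgs (0, 0, 0, u) ⟨le_rfl, fun x y => ?_⟩
    simp only [BoundedContinuousFunction.coe_zero, Pi.zero_apply, zero_add]
    have hu' : 0 ≤ u (i x, j y) := hu (i x, j y)
    rw [ENNReal.ofReal_of_nonpos (neg_nonpos.2 hu')]
    simp
  · have h1 := hgs (0, 0, 1, -u) ⟨zero_le_one, fun x y => by simpa using hu x y⟩
    rw [split] at h1
    have h3 : g (0, 0, 0, -u) = - g (0, 0, 0, u) := by rw [← map_neg]; simp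
    simp only [BoundedContinuousFunction.coe_zero, Pi.zero_apply, integral_zero] at h1
    change g (0, 0, 0, u) ≤ D
    linarith
  · simpa using eq_of φ 0 u (by simpa using hu)
  · simpa using eq_of 0 ψ u (by simpa using hu)

end Duality

/-- The Riesz-Markov-Kakutani theorem on a compact space, for functionals on `C(K, ℝ)`. -/
theorem exists_measure_of_positive {K : Type*} [TopologicalSpace K] [CompactSpace K] [T2Space K]
    [MeasurableSpace K] [BorelSpace K] (Λ : C(K, ℝ) →ₗ[ℝ] ℝ) (hΛ : ∀ u, 0 ≤ u → 0 ≤ Λ u) :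
    ∃ γ : Measure K, IsFiniteMeasure γ ∧ ∀ u : C(K, ℝ), ∫ z, u z ∂γ = Λ u := by
  let Λ' : CompactlySupportedContinuousMap K ℝ →ₚ[ℝ] ℝ :=
    { toFun := fun g => Λ g.toContinuousMap
      map_add' := fun g g' => map_add Λ g.toContinuousMap g'.toContinuousMap
      map_smul' := fun a g => map_smul Λ a g.toContinuousMap
      monotone' := fun g g' hgg' => by
        have := hΛ (g'.toContinuousMap - g.toContinuousMap) fun x => sub_nonneg.2 (hgg' x)
        rw [map_sub] at this
        exact sub_nonneg.1 this }
  refine ⟨RealRMK.rieszMeasure Λ', inferInstance, fun u => ?_⟩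
  exact RealRMK.integral_rieszMeasure Λ' ⟨u, HasCompactSupport.of_compactSpace _⟩

/-- The hard half of Kantorovich duality on Polish spaces, for a lower semicontinuous cost: a bound
on all the dual values bounds the cost of some coupling. -/
theorem exists_coupling_lintegral_le {X Y : Type*} [TopologicalSpace X] [PolishSpace X]
    [MeasurableSpace X] [BorelSpace X] [TopologicalSpace Y] [PolishSpace Y]
    [MeasurableSpace Y] [BorelSpace Y] (μ : Measure X) [IsFiniteMeasure μ]
    (ν : Measure Y) [IsFiniteMeasure ν] {c : X × Y → ℝ≥0∞} (hc : LowerSemicontinuous c) {D : ℝ}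
    (h : ∀ (φ : X →ᵇ ℝ) (ψ : Y →ᵇ ℝ), (∀ x y, ENNReal.ofReal (φ x + ψ y) ≤ c (x, y)) →
      ∫ x, φ x ∂μ + ∫ y, ψ y ∂ν ≤ D) :
    ∃ γ ∈ couplings μ ν, ∫⁻ p, c p ∂γ ≤ ENNReal.ofReal D := by
  let := TopologicalSpace.upgradeIsCompletelyMetrizable X
  let := TopologicalSpace.upgradeIsCompletelyMetrizable Y
  obtain ⟨i, hi⟩ := Metric.PiNatEmbed.exists_embedding_to_hilbert_cube (X := X)
  obtain ⟨j, hj⟩ := Metric.PiNatEmbed.exists_embedding_to_hilbert_cube (X := Y)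
  have hij : IsEmbedding (Prod.map i j) := hi.prodMap hj
  -- Polishness enters here: a continuous injection of a Polish space has Borel image, so measures
  -- can be pulled back.
  have mi : MeasurableEmbedding i := hi.continuous.measurableEmbedding hi.injective
  have mj : MeasurableEmbedding j := hj.continuous.measurableEmbedding hj.injective
  have mij : MeasurableEmbedding (Prod.map i j) :=
    hij.continuous.measurableEmbedding hij.injective
  obtain ⟨Λ, hpos, hle, hfst, hsnd⟩ := exists_functional_of_dual_le i j h
  obtain ⟨γ, hγ, hγΛ⟩ := exists_measure_of_positive Λ hpos
  have hγ1 : γ.map Prod.fst = μ.map i := by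
    refine ext_of_forall_integral_eq_of_IsFiniteMeasure fun f => ?_
    rw [integral_map (by fun_prop) (by fun_prop), integral_map mi.measurable.aemeasurable
      f.continuous.aestronglyMeasurable]
    exact (hγΛ (f.toContinuousMap.comp ContinuousMap.fst)).trans
      (hfst _ (f.compContinuous ⟨i, hi.continuous⟩) fun _ _ => rfl)
  have hγ2 : γ.map Prod.snd = ν.map j := by
    refine ext_of_forall_integral_eq_of_IsFiniteMeasure fun f => ?_
    rw [integral_map (by fun_prop) (by fun_prop), integral_map mj.measurable.aemeasurable
      f.continuous.aestronglyMeasurable]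
    exact (hγΛ (f.toContinuousMap.comp ContinuousMap.snd)).trans
      (hsnd _ (f.compContinuous ⟨j, hj.continuous⟩) fun _ _ => rfl)
  -- The marginals do not charge the complements of the images, hence no mass of `γ` is lost in the
  -- pullback.
  have hrange : γ (Set.range (Prod.map i j))ᶜ = 0 := by
    have h1 : γ (Prod.fst ⁻¹' (Set.range i)ᶜ) = 0 := by
      rw [← Measure.map_apply measurable_fst mi.measurableSet_range.compl, hγ1,
        Measure.map_apply mi.measurable mi.measurableSet_range.compl]
      simp
    have h2 : γ (Prod.snd ⁻¹' (Set.range j)ᶜ) = 0 := by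
      rw [← Measure.map_apply measurable_snd mj.measurableSet_range.compl, hγ2,
        Measure.map_apply mj.measurable mj.measurableSet_range.compl]
      simp
    refine measure_mono_null ?_ (measure_union_null h1 h2)
    rw [Set.range_prodMap, Set.compl_prod_eq_union]
    rintro ⟨a, b⟩ (hp | hp)
    · exact Or.inl hp.1
    · exact Or.inr hp.2
  have hmap : (γ.comap (Prod.map i j)).map (Prod.map i j) = γ := by
    rw [mij.map_comap]
    exact Measure.restrict_eq_self_of_ae_mem hrange
  refine ⟨γ.comap (Prod.map i j), ⟨?_, ?_⟩, ?_⟩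
  · rw [← mi.comap_map μ, ← hγ1]
    conv_rhs => rw [← hmap]
    rw [Measure.map_map measurable_fst mij.measurable]
    rw [← mi.comap_map ((γ.comap (Prod.map i j)).map Prod.fst),
      Measure.map_map mi.measurable measurable_fst]
    rfl
  · rw [← mj.comap_map ν, ← hγ2]
    conv_rhs => rw [← hmap]
    rw [Measure.map_map measurable_snd mij.measurable]
    rw [← mj.comap_map ((γ.comap (Prod.map i j)).map Prod.snd),
      Measure.map_map mj.measurable measurable_snd]
    rfl
  · obtain ⟨v, hv, hv0, hvc⟩ := exists_monotone_continuousMap_iSup_eq hij hc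
    have hvle : ∀ n w, ENNReal.ofReal (v n (Prod.map i j w)) ≤ c w := fun n w => by
      rw [← hvc w]
      exact le_iSup (fun n => ENNReal.ofReal (v n (Prod.map i j w))) n
    simp_rw [← hvc]
    rw [lintegral_iSup
      (f := fun n (w : X × Y) => ENNReal.ofReal (v n (Prod.map i j w)))
      (fun n => (ENNReal.continuous_ofReal.comp
        ((v n).continuous.comp hij.continuous)).measurable)
      (fun m n hmn w => ENNReal.ofReal_le_ofReal (hv hmn _))]
    refine iSup_le fun n => ?_
    rw [← mij.lintegral_map (fun z => ENNReal.ofReal (v n z)), hmap,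
      ← ofReal_integral_eq_lintegral_ofReal
        ((v n).continuous.integrable_of_hasCompactSupport (HasCompactSupport.of_compactSpace _))
        (Eventually.of_forall (hv0 n))]
    exact ENNReal.ofReal_le_ofReal ((hγΛ (v n)).trans_le (hle _ fun x y => hvle n (x, y)))

/-! ### Cutoff, smoothing and normalization -/

section Cutoff

variable {E : Type*} [NormedAddCommGroup E]

/-- A continuous cutoff function, equal to `1` on the ball of radius `n` and to `0` outside the ball
of radius `n + 1`. -/
noncomputable def cutoff (n : ℕ) (x : E) : ℝ := max 0 (min 1 (n + 1 - ‖x‖))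

theorem continuous_cutoff (n : ℕ) : Continuous (cutoff n : E → ℝ) := by
  unfold cutoff; fun_prop

theorem cutoff_nonneg (n : ℕ) (x : E) : 0 ≤ cutoff n x := le_max_left _ _

theorem cutoff_le_one (n : ℕ) (x : E) : cutoff n x ≤ 1 :=
  max_le zero_le_one (min_le_left _ _)

theorem cutoff_eq_one {n : ℕ} {x : E} (h : ‖x‖ ≤ n) : cutoff n x = 1 := by
  rw [cutoff, min_eq_left (by linarith), max_eq_right zero_le_one]

theorem cutoff_eq_zero {n : ℕ} {x : E} (h : (n : ℝ) + 1 ≤ ‖x‖) : cutoff n x = 0 := by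
  rw [cutoff, max_eq_left ((min_le_right _ _).trans (by linarith))]

theorem hasCompactSupport_cutoff_mul [ProperSpace E] (n : ℕ) (f : E → ℝ) :
    HasCompactSupport fun x => cutoff n x * f x := by
  refine HasCompactSupport.intro (isCompact_closedBall (0 : E) (n + 1)) fun x hx => ?_
  rw [cutoff_eq_zero, zero_mul]
  simpa using (not_le.1 (by simpa using hx)).le

theorem tendsto_integral_cutoff_mul [MeasurableSpace E] [OpensMeasurableSpace E] (μ : Measure E)
    [IsFiniteMeasure μ] (f : E →ᵇ ℝ) :
    Tendsto (fun n => ∫ x, cutoff n x * f x ∂μ) atTop (𝓝 (∫ x, f x ∂μ)) := by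
  refine tendsto_integral_of_dominated_convergence (fun x => ‖f x‖) (fun n => ?_)
    (f.integrable μ).norm (fun n => ?_) ?_
  · exact ((continuous_cutoff n).measurable.mul f.continuous.measurable).aestronglyMeasurable
  · refine Eventually.of_forall fun x => ?_
    rw [norm_mul, Real.norm_of_nonneg (cutoff_nonneg n x)]
    exact mul_le_of_le_one_left (norm_nonneg _) (cutoff_le_one n x)
  · refine Eventually.of_forall fun x => tendsto_const_nhds.congr' ?_
    obtain ⟨N, hN⟩ := exists_nat_ge ‖x‖
    filter_upwards [eventually_ge_atTop N] with n hn
    rw [cutoff_eq_one (hN.trans (by exact_mod_cast hn)), one_mul]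

end Cutoff

/-- A compactly supported continuous function is a uniform limit from below of smooth compactly
supported functions. -/
theorem exists_contDiff_le_of_hasCompactSupport {E : Type*} [NormedAddCommGroup E]
    [NormedSpace ℝ E] [FiniteDimensional ℝ E] {f : E → ℝ} (hf : Continuous f)
    (hf' : HasCompactSupport f) {η : ℝ} (hη : 0 < η) :
    ∃ g : E → ℝ, ContDiff ℝ (⊤ : ℕ∞) g ∧ HasCompactSupport g ∧ (∀ x, g x ≤ f x) ∧
      ∀ x, f x - η ≤ g x := by
  obtain ⟨g, hg, hgf, hsupp⟩ := hf.exists_contDiff_approx (⊤ : ℕ∞) (ε := fun _ => η / 2)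
    continuous_const (fun _ => half_pos hη)
  obtain ⟨R, hR⟩ := hf'.isCompact.isBounded.subset_closedBall (0 : E)
  -- The bump is `1` on the support of `f`. Subtracting `η / 2` times it pushes the approximant
  -- below `f` without destroying compact support.
  let b : ContDiffBump (0 : E) := ⟨max R 1, max R 1 + 1, by positivity, by linarith⟩
  have hb : ∀ x, f x ≠ 0 → b x = 1 := fun x hx => b.one_of_mem_closedBall
    (Metric.closedBall_subset_closedBall (le_max_left R 1) (hR (subset_tsupport f hx)))
  have hg0 : ∀ x, f x = 0 → g x = 0 := fun x hx => by
    by_contra h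
    exact hsupp h hx
  have hdist : ∀ x, |g x - f x| < η / 2 := hgf
  refine ⟨fun x => g x - η / 2 * b x, hg.sub (contDiff_const.mul b.contDiff), ?_, fun x => ?_,
    fun x => ?_⟩
  · exact (hf'.mono hsupp).sub b.hasCompactSupport.mul_left
  · by_cases hx : f x = 0
    · simp only [hg0 x hx, hx]
      nlinarith [b.nonneg (x := x)]
    · have := abs_lt.1 (hdist x)
      simp only [hb x hx]
      linarith
  · by_cases hx : f x = 0
    · simp only [hg0 x hx, hx]
      nlinarith [b.le_one (x := x)]
    · have := abs_lt.1 (hdist x)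
      simp only [hb x hx]
      linarith

/-- Translating and truncating a dual pair so that `inf φ = 0` and `sup ψ ≥ 0`. -/
theorem exists_normalized_pair {E F : Type*} [TopologicalSpace E] [MeasurableSpace E]
    [OpensMeasurableSpace E] [TopologicalSpace F] [MeasurableSpace F] [OpensMeasurableSpace F]
    (μ : Measure E) [IsProbabilityMeasure μ] (ν : Measure F) [IsProbabilityMeasure ν]
    {c : E × F → ℝ≥0∞} (φ : E →ᵇ ℝ) (ψ : F →ᵇ ℝ)
    (h : ∀ x y, ENNReal.ofReal (φ x + ψ y) ≤ c (x, y)) :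
    ∃ (φ' : E →ᵇ ℝ) (ψ' : F →ᵇ ℝ), (∀ x y, ENNReal.ofReal (φ' x + ψ' y) ≤ c (x, y)) ∧
      (∀ x, 0 ≤ φ' x) ∧ (∀ ε > 0, ∃ x, φ' x < ε) ∧ (∀ ε > 0, ∃ y, -ε < ψ' y) ∧
      ∫ x, φ x ∂μ + ∫ y, ψ y ∂ν ≤ ∫ x, φ' x ∂μ + ∫ y, ψ' y ∂ν := by
  have hE : Nonempty E := nonempty_of_isProbabilityMeasure μ
  have hF : Nonempty F := nonempty_of_isProbabilityMeasure ν
  have bdd : BddAbove (Set.range ψ) := ψ.isBounded_range.bddAbove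
  let s := ⨆ y, ψ y
  -- Raising `φ` to `-sup ψ` is harmless, since `-sup ψ + ψ ≤ 0 ≤ c`. It ensures `inf φ₀ ≥ -sup ψ`,
  -- so moving the constant `inf φ₀` from `φ₀` to `ψ` leaves `sup ψ' ≥ 0`.
  let φ₀ : E →ᵇ ℝ := φ ⊔ BoundedContinuousFunction.const E (-s)
  have hφ₀ : ∀ x, φ₀ x = max (φ x) (-s) := fun x => rfl
  have bdd₀ : BddBelow (Set.range φ₀) := φ₀.isBounded_range.bddBelow
  let i := ⨅ x, φ₀ x
  have hi : -s ≤ i := le_ciInf fun x => le_max_right _ _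
  refine ⟨φ₀ - BoundedContinuousFunction.const E i, ψ + BoundedContinuousFunction.const F i,
    fun x y => ?_, fun x => ?_, fun ε hε => ?_, fun ε hε => ?_, ?_⟩
  · have : (φ₀ - BoundedContinuousFunction.const E i) x +
        (ψ + BoundedContinuousFunction.const F i) y = max (φ x + ψ y) (-s + ψ y) := by
      simp [hφ₀, max_add_add_right]
    rw [this, ENNReal.ofReal_max]
    refine max_le (h x y) ?_
    rw [ENNReal.ofReal_of_nonpos]
    · exact zero_le
    · linarith [le_ciSup bdd y]
  · simpa using ciInf_le bdd₀ x
  · obtain ⟨x, hx⟩ := exists_lt_of_ciInf_lt (show i < i + ε by linarith)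
    exact ⟨x, by simpa using by linarith⟩
  · obtain ⟨y, hy⟩ := exists_lt_of_lt_ciSup (show s - ε < s by linarith)
    refine ⟨y, ?_⟩
    simp only [BoundedContinuousFunction.coe_add, Pi.add_apply,
      BoundedContinuousFunction.const_apply]
    linarith
  · have h1 : ∫ x, φ x ∂μ ≤ ∫ x, φ₀ x ∂μ :=
      integral_mono (φ.integrable μ) (φ₀.integrable μ) fun x => le_max_left _ _
    have h2 : ∫ x, (φ₀ - BoundedContinuousFunction.const E i) x ∂μ = ∫ x, φ₀ x ∂μ - i := by
      simp only [BoundedContinuousFunction.coe_sub, Pi.sub_apply,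
        BoundedContinuousFunction.const_apply]
      rw [integral_sub (φ₀.integrable μ) (integrable_const i)]
      simp
    have h3 : ∫ y, (ψ + BoundedContinuousFunction.const F i) y ∂ν = ∫ y, ψ y ∂ν + i := by
      simp only [BoundedContinuousFunction.coe_add, Pi.add_apply,
        BoundedContinuousFunction.const_apply]
      rw [integral_add (ψ.integrable ν) (integrable_const i)]
      simp
    rw [h2, h3]
    linarith

/-- Evaluate the constraint at a `y` with `ψ y` almost nonnegative. This links `φ` to the supremum
of the cost that appears in local coercivity. -/
theorem ofReal_le_iSup_of_normalized {E F : Type*} {c : E × F → ℝ≥0∞} {φ : E → ℝ} {ψ : F → ℝ}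
    (h : ∀ x y, ENNReal.ofReal (φ x + ψ y) ≤ c (x, y)) (hψ : ∀ ε > 0, ∃ y, -ε < ψ y) (x : E) :
    ENNReal.ofReal (φ x) ≤ ⨆ y, c (x, y) := by
  refine ENNReal.le_of_forall_pos_le_add fun ε hε _ => ?_
  obtain ⟨y, hy⟩ := hψ ε hε
  calc ENNReal.ofReal (φ x) ≤ ENNReal.ofReal (φ x + ψ y + ε) :=
        ENNReal.ofReal_le_ofReal (by linarith)
    _ ≤ ENNReal.ofReal (φ x + ψ y) + ENNReal.ofReal ε := ENNReal.ofReal_add_le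
    _ ≤ (⨆ y, c (x, y)) + ε := by
        rw [ENNReal.ofReal_coe_nnreal]
        gcongr
        exact (h x y).trans (le_iSup (fun y => c (x, y)) y)

/-! ### Compactly supported dual pairs in finite dimension -/

section FiniteDimensional

variable {E F : Type*} [NormedAddCommGroup E] [NormedSpace ℝ E] [FiniteDimensional ℝ E]
  [MeasurableSpace E] [BorelSpace E] [NormedAddCommGroup F] [NormedSpace ℝ F]
  [FiniteDimensional ℝ F] [MeasurableSpace F] [BorelSpace F]

/-- Local coercivity allows a dual pair to be cut off at infinity. -/
theorem exists_compactlySupported_pair (μ : Measure E) [IsProbabilityMeasure μ] (ν : Measure F)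
    [IsProbabilityMeasure ν] {c : E × F → ℝ≥0∞} (hc : LocallyCoercive c) (φ : E →ᵇ ℝ)
    (ψ : F →ᵇ ℝ) (h : ∀ x y, ENNReal.ofReal (φ x + ψ y) ≤ c (x, y)) (hφ : ∀ x, 0 ≤ φ x)
    (hψ : ∀ ε > 0, ∃ y, -ε < ψ y) {ε : ℝ} (hε : 0 < ε) :
    ∃ (f : E → ℝ) (g : F → ℝ), Continuous f ∧ HasCompactSupport f ∧ Continuous g ∧
      HasCompactSupport g ∧ (∀ x y, ENNReal.ofReal (f x + g y) ≤ c (x, y)) ∧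
      (∀ x, 0 ≤ f x) ∧ (∀ x, f x ≤ φ x) ∧ (∀ y, -(⨆ x, f x) ≤ g y) ∧ (∀ ε > 0, ∃ y, -ε < g y) ∧
      ∫ x, φ x ∂μ + ∫ y, ψ y ∂ν - 3 * ε ≤ ∫ x, f x ∂μ + ∫ y, g y ∂ν := by
  -- Lowering `φ` by `ε` creates the gap `f x + ε ≤ φ x ≤ sup_y c (x, y)` wherever `f x > 0`, as
  -- local coercivity requires. The loss `3 * ε` is this `ε` plus one for each cutoff.
  let φ₁ : E →ᵇ ℝ := (φ - BoundedContinuousFunction.const E ε) ⊔ 0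
  have hφ₁ : ∀ x, φ₁ x = max (φ x - ε) 0 := fun x => rfl
  have hφ₁0 : ∀ x, 0 ≤ φ₁ x := fun x => le_max_right _ _
  have hφ₁φ : ∀ x, φ₁ x ≤ φ x := fun x => by
    rw [hφ₁]; exact max_le (by linarith) (hφ x)
  obtain ⟨n, hn⟩ := ((tendsto_integral_cutoff_mul μ φ₁).eventually
    (lt_mem_nhds (sub_lt_self _ hε))).exists
  let f : E → ℝ := fun x => cutoff n x * φ₁ x
  have hf0 : ∀ x, 0 ≤ f x := fun x => mul_nonneg (cutoff_nonneg n x) (hφ₁0 x)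
  have hfφ₁ : ∀ x, f x ≤ φ₁ x := fun x =>
    mul_le_of_le_one_left (hφ₁0 x) (cutoff_le_one n x)
  have hfφ : ∀ x, f x ≤ φ x := fun x => (hfφ₁ x).trans (hφ₁φ x)
  have hfbdd : BddAbove (Set.range f) := ⟨‖φ‖, by
    rintro _ ⟨x, rfl⟩
    exact (hfφ x).trans ((le_abs_self _).trans (φ.norm_coe_le_norm x))⟩
  let S := ⨆ x, f x
  have hfS : ∀ x, f x ≤ S := le_ciSup hfbdd
  have hS : 0 ≤ S := (hf0 0).trans (hfS 0)
  obtain ⟨W, hW, hWc⟩ := hc (Metric.closedBall 0 (n + 1))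
    (NormedSpace.isVonNBounded_closedBall ℝ E _) ε.toNNReal (Real.toNNReal_pos.2 hε)
    (‖φ‖ + 1).toNNReal (Real.toNNReal_pos.2 (by positivity))
  -- If `c (x, y) < f x`, then `f x > 0`, so `x` lies in the ball and `c (x, y)` is below both
  -- coercivity thresholds; thus `y ∈ W`.
  have hfar : ∀ x, ∀ y ∉ W, ENNReal.ofReal (f x) ≤ c (x, y) := by
    intro x y hy
    rcases (hf0 x).eq_or_lt with h0 | h0
    · rw [← h0, ENNReal.ofReal_zero]; exact zero_le
    by_contra! hlt
    have hxV : x ∈ Metric.closedBall (0 : E) (n + 1) := by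
      by_contra hx
      have : f x = 0 := by
        have : cutoff n x = 0 := cutoff_eq_zero (by simpa using (not_le.1 (by simpa using hx)).le)
        simp only [f, this, zero_mul]
      linarith
    refine hy (hWc x hxV y (lt_min (hlt.trans_le ?_) (hlt.trans_le ?_)))
    · refine ENNReal.le_sub_of_add_le_right ENNReal.coe_ne_top ?_
      have h1 : f x + ε ≤ φ x := by
        have h2 := hfφ₁ x
        rw [hφ₁] at h2
        rcases le_max_iff.1 h2 with h3 | h3 <;> linarith
      change ENNReal.ofReal (f x) + ENNReal.ofReal ε ≤ _
      rw [← ENNReal.ofReal_add (hf0 x) hε.le]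
      exact (ENNReal.ofReal_le_ofReal h1).trans (ofReal_le_iSup_of_normalized h hψ x)
    · refine ENNReal.ofReal_le_ofReal ?_
      have := (le_abs_self _).trans (φ.norm_coe_le_norm x)
      linarith [hfφ x]
  -- The bound `f - S ≤ 0` makes this truncation admissible and supplies the lower bound on `g`.
  let ψ₁ : F →ᵇ ℝ := ψ ⊔ BoundedContinuousFunction.const F (-S)
  have hψ₁ : ∀ y, ψ₁ y = max (ψ y) (-S) := fun y => rfl
  have hsum : ∀ x y, ENNReal.ofReal (f x + ψ₁ y) ≤ c (x, y) := by
    intro x y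
    rw [hψ₁, ← max_add_add_left, ENNReal.ofReal_max]
    refine max_le ((ENNReal.ofReal_le_ofReal (by linarith [hfφ x])).trans (h x y)) ?_
    rw [ENNReal.ofReal_of_nonpos (by linarith [hfS x])]
    exact zero_le
  obtain ⟨R, hR⟩ := (NormedSpace.isVonNBounded_iff ℝ).1 hW |>.subset_closedBall (0 : F)
  obtain ⟨N, hN⟩ := exists_nat_ge R
  obtain ⟨m, hm, hmN⟩ := (((tendsto_integral_cutoff_mul ν ψ₁).eventually
    (lt_mem_nhds (sub_lt_self _ hε))).and (eventually_ge_atTop N)).exists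
  have hWm : ∀ y ∈ W, cutoff m y = 1 := fun y hy => cutoff_eq_one <| by
    have h1 : ‖y‖ ≤ R := by simpa using hR hy
    exact h1.trans (hN.trans (by exact_mod_cast hmN))
  have hsplit : ∀ y, 0 ≤ ψ₁ y ∧ cutoff m y * ψ₁ y ≤ ψ₁ y ∧ 0 ≤ cutoff m y * ψ₁ y ∨
      ψ₁ y < 0 ∧ ψ₁ y ≤ cutoff m y * ψ₁ y ∧ cutoff m y * ψ₁ y ≤ 0 := by
    intro y
    have h0 := cutoff_nonneg m y
    have h1 := cutoff_le_one m y
    rcases le_or_gt 0 (ψ₁ y) with h2 | h2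
    · exact Or.inl ⟨h2, mul_le_of_le_one_left h2 h1, mul_nonneg h0 h2⟩
    · exact Or.inr ⟨h2, by nlinarith, mul_nonpos_of_nonneg_of_nonpos h0 h2.le⟩
  refine ⟨f, fun y => cutoff m y * ψ₁ y, (continuous_cutoff n).mul φ₁.continuous,
    hasCompactSupport_cutoff_mul n _, (continuous_cutoff m).mul ψ₁.continuous,
    hasCompactSupport_cutoff_mul m _, fun x y => ?_, hf0, hfφ, fun y => ?_, fun ε hε => ?_, ?_⟩
  -- The cutoff can raise `ψ₁` only where `ψ₁ < 0`. There it changes nothing on `W`, and off `W` it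
  -- stays nonpositive while `f x ≤ c (x, y)` already holds.
  · rcases hsplit y with ⟨-, h1, -⟩ | ⟨-, -, h1⟩
    · exact (ENNReal.ofReal_le_ofReal (by linarith)).trans (hsum x y)
    · by_cases hy : y ∈ W
      · simpa only [hWm y hy, one_mul] using hsum x y
      · exact (ENNReal.ofReal_le_ofReal (by linarith)).trans (hfar x y hy)
  · have h1 : -S ≤ ψ₁ y := le_max_right _ _
    rcases hsplit y with ⟨-, -, h2⟩ | ⟨-, h2, -⟩
    · exact (neg_nonpos.2 hS).trans h2
    · exact h1.trans h2
  · obtain ⟨y, hy⟩ := hψ ε hε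
    have h1 : ψ y ≤ ψ₁ y := le_max_left _ _
    refine ⟨y, ?_⟩
    rcases hsplit y with ⟨-, -, h2⟩ | ⟨-, h2, -⟩ <;> linarith
  · have h1 : ∫ x, φ x ∂μ - ε ≤ ∫ x, φ₁ x ∂μ := by
      have : ∫ x, φ x ∂μ - ε = ∫ x, (φ x - ε) ∂μ := by
        rw [integral_sub (φ.integrable μ) (integrable_const ε)]
        simp
      rw [this]
      exact integral_mono ((φ.integrable μ).sub (integrable_const ε)) (φ₁.integrable μ)
        fun x => le_max_left _ _
    have h2 : ∫ y, ψ y ∂ν ≤ ∫ y, ψ₁ y ∂ν :=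
      integral_mono (ψ.integrable ν) (ψ₁.integrable ν) fun y => le_max_left _ _
    linarith

/-- In finite dimension, for a locally coercive cost, bounded continuous dual pairs can be replaced
by smooth compactly supported ones that satisfy the relaxed bounds. -/
theorem exists_smooth_pair (μ : Measure E) [IsProbabilityMeasure μ] (ν : Measure F)
    [IsProbabilityMeasure ν] {c : E × F → ℝ≥0∞} (hc : LocallyCoercive c) (φ : E →ᵇ ℝ)
    (ψ : F →ᵇ ℝ) (h : ∀ x y, ENNReal.ofReal (φ x + ψ y) ≤ c (x, y)) {δ ε : ℝ} (hδ : 0 < δ)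
    (hε : 0 < ε) :
    ∃ (f : E → ℝ) (g : F → ℝ), ContDiff ℝ (⊤ : ℕ∞) f ∧ HasCompactSupport f ∧
      ContDiff ℝ (⊤ : ℕ∞) g ∧ HasCompactSupport g ∧
      (∀ x y, ENNReal.ofReal (f x + g y) ≤ c (x, y)) ∧
      -δ ≤ (⨅ x, f x) ∧ (⨅ x, f x) ≤ 0 ∧ ENNReal.ofReal (⨆ x, f x) ≤ ⨆ q, c q ∧
      (∀ y, -(⨆ x, f x) - δ ≤ g y) ∧ -δ ≤ (⨆ y, g y) ∧
      ∫ x, φ x ∂μ + ∫ y, ψ y ∂ν - ε ≤ ∫ x, f x ∂μ + ∫ y, g y ∂ν := by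
  obtain ⟨φ', ψ', h', hφ'0, hφ', hψ', hint'⟩ := exists_normalized_pair μ ν φ ψ h
  obtain ⟨φ₁, ψ₁, cφ₁, sφ₁, cψ₁, sψ₁, h₁, hφ₁0, hφ₁, hψ₁S, hψ₁, hint₁⟩ :=
    exists_compactlySupported_pair μ ν hc φ' ψ' h' hφ'0 hψ' (show 0 < ε / 6 by positivity)
  -- The cutoff loses `3 * (ε / 6) = ε / 2`, and smoothing two functions at most `2 * η ≤ ε / 2`.
  -- The bounds on `g` each lose at most `2 * η ≤ δ`.
  let η := min (δ / 2) (ε / 4)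
  have hη : 0 < η := lt_min (by positivity) (by positivity)
  have hηδ : η ≤ δ / 2 := min_le_left _ _
  have hηε : η ≤ ε / 4 := min_le_right _ _
  obtain ⟨f, df, sf, hf, hf'⟩ := exists_contDiff_le_of_hasCompactSupport cφ₁ sφ₁ hη
  obtain ⟨g, dg, sg, hg, hg'⟩ := exists_contDiff_le_of_hasCompactSupport cψ₁ sψ₁ hη
  have hfη : ∀ x, -η ≤ f x := fun x => by linarith [hf' x, hφ₁0 x]
  have fbelow : BddBelow (Set.range f) := ⟨-η, by rintro _ ⟨x, rfl⟩; exact hfη x⟩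
  have fabove : BddAbove (Set.range f) := (sf.isCompact_range df.continuous).bddAbove
  have gabove : BddAbove (Set.range g) := (sg.isCompact_range dg.continuous).bddAbove
  refine ⟨f, g, df, sf, dg, sg, fun x y => ?_, ?_, ?_, ?_, fun y => ?_, ?_, ?_⟩
  · exact (ENNReal.ofReal_le_ofReal (add_le_add (hf x) (hg y))).trans (h₁ x y)
  · exact le_ciInf fun x => by linarith [hfη x]
  · refine le_of_forall_pos_le_add fun ε hε => ?_
    obtain ⟨x, hx⟩ := hφ' ε hε
    linarith [ciInf_le fbelow x, hf x, hφ₁ x]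
  · have hle : ∀ x, ENNReal.ofReal (f x) ≤ ⨆ q, c q := fun x =>
      ((ENNReal.ofReal_le_ofReal ((hf x).trans (hφ₁ x))).trans
        (ofReal_le_iSup_of_normalized h' hψ' x)).trans
          (iSup_le fun y => le_iSup c (x, y))
    rcases eq_or_ne (⨆ q, c q) ⊤ with htop | htop
    · rw [htop]; exact le_top
    · rw [ENNReal.ofReal_le_iff_le_toReal htop]
      exact ciSup_le fun x => (ENNReal.ofReal_le_iff_le_toReal htop).1 (hle x)
  · have : ⨆ x, φ₁ x ≤ (⨆ x, f x) + η :=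
      ciSup_le fun x => by linarith [le_ciSup fabove x, hf' x]
    linarith [hg' y, hψ₁S y]
  · obtain ⟨y, hy⟩ := hψ₁ η hη
    linarith [le_ciSup gabove y, hg' y]
  · have h1 : ∫ x, φ₁ x ∂μ - η ≤ ∫ x, f x ∂μ := by
      have i1 := cφ₁.integrable_of_hasCompactSupport (μ := μ) sφ₁
      have : ∫ x, φ₁ x ∂μ - η = ∫ x, (φ₁ x - η) ∂μ := by
        rw [integral_sub i1 (integrable_const η)]
        simp
      rw [this]
      exact integral_mono (i1.sub (integrable_const η))
        (df.continuous.integrable_of_hasCompactSupport sf) hf'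
    have h2 : ∫ y, ψ₁ y ∂ν - η ≤ ∫ y, g y ∂ν := by
      have i1 := cψ₁.integrable_of_hasCompactSupport (μ := ν) sψ₁
      have : ∫ y, ψ₁ y ∂ν - η = ∫ y, (ψ₁ y - η) ∂ν := by
        rw [integral_sub i1 (integrable_const η)]
        simp
      rw [this]
      exact integral_mono (i1.sub (integrable_const η))
        (dg.continuous.integrable_of_hasCompactSupport sg) hg'
    linarith

end FiniteDimensional

/-! ### Weak duality -/

theorem coe_le_coe_of_ofReal_le {r : ℝ} {a : ℝ≥0∞} (h : ENNReal.ofReal r ≤ a) :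
    (r : EReal) ≤ (a : EReal) := by
  refine le_trans ?_ (EReal.coe_ennreal_le_coe_ennreal_iff.2 h)
  rw [EReal.coe_ennreal_ofReal]
  exact_mod_cast le_max_left r 0

theorem ofReal_le_of_coe_le_coe {r : ℝ} {a : ℝ≥0∞} (h : (r : EReal) ≤ (a : EReal)) :
    ENNReal.ofReal r ≤ a := by
  rw [← EReal.coe_ennreal_le_coe_ennreal_iff, EReal.coe_ennreal_ofReal]
  rcases max_cases r 0 with ⟨h1, -⟩ | ⟨h1, -⟩ <;> rw [h1]
  · exact h
  · exact EReal.coe_ennreal_nonneg a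

theorem ofReal_integral_le_lintegral_ofReal {Ω : Type*} [MeasurableSpace Ω] {γ : Measure Ω}
    {u : Ω → ℝ} (hu : Integrable u γ) :
    ENNReal.ofReal (∫ z, u z ∂γ) ≤ ∫⁻ z, ENNReal.ofReal (u z) ∂γ := by
  rw [integral_eq_lintegral_pos_part_sub_lintegral_neg_part hu]
  exact (ENNReal.ofReal_le_ofReal (sub_le_self _ ENNReal.toReal_nonneg)).trans
    ENNReal.ofReal_toReal_le

/-- Weak duality. -/
theorem dual_le_transportCost {X Y : Type*} [MeasurableSpace X] [MeasurableSpace Y]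
    {c : X × Y → ℝ≥0∞} {μ : Measure X} {ν : Measure Y} {p : (X → ℝ) × (Y → ℝ)}
    (hp : p ∈ dualPairs c μ ν) :
    ((∫ x, p.1 x ∂μ + ∫ y, p.2 y ∂ν : ℝ) : EReal) ≤ transportCost c μ ν := by
  obtain ⟨h1, h2, A, B, hA, hB, h⟩ := hp
  refine coe_le_coe_of_ofReal_le (le_iInf₂ fun γ hγ => ?_)
  obtain ⟨rfl, rfl⟩ := hγ
  have hA' : ∀ᵐ z ∂γ, z.1 ∈ A := ae_of_ae_map measurable_fst.aemeasurable hA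
  have hB' : ∀ᵐ z ∂γ, z.2 ∈ B := ae_of_ae_map measurable_snd.aemeasurable hB
  rw [integral_map measurable_fst.aemeasurable h1.aestronglyMeasurable,
    integral_map measurable_snd.aemeasurable h2.aestronglyMeasurable]
  have i1 : Integrable (fun z : X × Y => p.1 z.1) γ := h1.comp_measurable measurable_fst
  have i2 : Integrable (fun z : X × Y => p.2 z.2) γ := h2.comp_measurable measurable_snd
  rw [← integral_add i1 i2]
  refine (ofReal_integral_le_lintegral_ofReal (i1.add i2)).trans (lintegral_mono_ae ?_)
  filter_upwards [hA', hB'] with z hzA hzB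
  exact ofReal_le_of_coe_le_coe (h z.1 hzA z.2 hzB)

/-! ### Reduction to finite-rank cylindrical functions -/

section TopologicalVectorSpace

variable {X : Type*} [AddCommGroup X] [Module ℝ X] [TopologicalSpace X] [IsTopologicalAddGroup X]
  [ContinuousSMul ℝ X] [T2Space X]

/-- A space in which finite rank operators approximate the identity pointwise is separable. -/
theorem separableSpace_of_tendsto_finiteRank (P : ℕ → X →L[ℝ] X)
    (hPfin : ∀ k, FiniteDimensional ℝ (LinearMap.range (P k).toLinearMap))
    (hP : ∀ x, Tendsto (fun k => P k x) atTop (𝓝 x)) : TopologicalSpace.SeparableSpace X := by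
  rw [← TopologicalSpace.isSeparable_univ_iff]
  have hsep : TopologicalSpace.IsSeparable
      (⋃ k, (LinearMap.range (P k).toLinearMap : Set X)) := by
    refine TopologicalSpace.IsSeparable.iUnion fun k => ?_
    have := hPfin k
    have h := TopologicalSpace.isSeparable_range (continuous_subtype_val.comp
      (toEuclidean (E := LinearMap.range (P k).toLinearMap)).symm.continuous)
    rwa [Set.range_comp, (toEuclidean (E := LinearMap.range (P k).toLinearMap)).symm.surjective.range_eq,
      Set.image_univ, Subtype.range_coe] at h
  refine hsep.closure.mono fun x _ => ?_
  exact mem_closure_of_tendsto (hP x)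
    (Eventually.of_forall fun k => Set.mem_iUnion.2 ⟨k, x, rfl⟩)

theorem LocallyCoercive.comp_equiv {E E' F F' : Type*} [AddCommGroup E] [Module ℝ E]
    [TopologicalSpace E] [AddCommGroup E'] [Module ℝ E'] [TopologicalSpace E'] [AddCommGroup F]
    [Module ℝ F] [TopologicalSpace F] [AddCommGroup F'] [Module ℝ F'] [TopologicalSpace F']
    {c : E × F → ℝ≥0∞} (hc : LocallyCoercive c) (e : E' ≃L[ℝ] E) (f : F' ≃L[ℝ] F) :
    LocallyCoercive fun z : E' × F' => c (e z.1, f z.2) := by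
  intro V hV δ hδ M hM
  obtain ⟨W, hW, hWc⟩ := hc (e '' V) (hV.image (e : E' →L[ℝ] E)) δ hδ M hM
  refine ⟨f.symm '' W, hW.image (f.symm : F →L[ℝ] F'), fun x hx y hy => ?_⟩
  refine ⟨f y, hWc (e x) (Set.mem_image_of_mem e hx) (f y) ?_, f.symm_apply_apply y⟩
  rwa [← f.surjective.iSup_comp]

variable {Y : Type*} [AddCommGroup Y] [Module ℝ Y] [TopologicalSpace Y] [IsTopologicalAddGroup Y]
  [ContinuousSMul ℝ Y] [T2Space Y] [MeasurableSpace X] [BorelSpace X] [MeasurableSpace Y]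
  [BorelSpace Y]

/-- A bounded continuous dual pair, composed with finite rank operators that decrease the cost, can
be replaced by a relaxed dual pair of cylindrical functions. -/
theorem exists_cylindrical_pair (P : X →L[ℝ] X) (Q : Y →L[ℝ] Y)
    [FiniteDimensional ℝ (LinearMap.range P.toLinearMap)]
    [FiniteDimensional ℝ (LinearMap.range Q.toLinearMap)] {c : X × Y → ℝ≥0∞}
    (hcoer : LocallyCoercive (restrictCost c P Q)) (hle : ∀ x y, c (P x, Q y) ≤ c (x, y))
    (μ : Measure X) [IsProbabilityMeasure μ] (ν : Measure Y) [IsProbabilityMeasure ν]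
    (φ : X →ᵇ ℝ) (ψ : Y →ᵇ ℝ) (h : ∀ x y, ENNReal.ofReal (φ x + ψ y) ≤ c (x, y)) {δ ε : ℝ}
    (hδ : 0 < δ) (hε : 0 < ε) :
    ∃ p ∈ relaxedDualPairs c μ ν δ ∩ (cylindrical P ×ˢ cylindrical Q),
      ∫ x, φ (P x) ∂μ + ∫ y, ψ (Q y) ∂ν - ε ≤ ∫ x, p.1 x ∂μ + ∫ y, p.2 y ∂ν := by
  let ι := toEuclidean (E := LinearMap.range P.toLinearMap)
  let κ := toEuclidean (E := LinearMap.range Q.toLinearMap)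
  let a := fun x : X => ι ⟨P x, x, rfl⟩
  let b := fun y : Y => κ ⟨Q y, y, rfl⟩
  have ca : Continuous a := ι.continuous.comp (P.continuous.subtype_mk _)
  have cb : Continuous b := κ.continuous.comp (Q.continuous.subtype_mk _)
  have sa : Function.Surjective a := ι.surjective.comp fun ⟨_, x, hx⟩ => ⟨x, Subtype.ext hx⟩
  have sb : Function.Surjective b := κ.surjective.comp fun ⟨_, y, hy⟩ => ⟨y, Subtype.ext hy⟩
  have hι : ∀ x, (ι.symm (a x) : X) = P x := fun x => by simp [a]
  have hκ : ∀ y, (κ.symm (b y) : Y) = Q y := fun y => by simp [b]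
  have : IsProbabilityMeasure (μ.map a) :=
    Measure.isProbabilityMeasure_map ca.measurable.aemeasurable
  have : IsProbabilityMeasure (ν.map b) :=
    Measure.isProbabilityMeasure_map cb.measurable.aemeasurable
  let φ' := φ.compContinuous ⟨fun z => (ι.symm z : X),
    continuous_subtype_val.comp ι.symm.continuous⟩
  let ψ' := ψ.compContinuous ⟨fun z => (κ.symm z : Y),
    continuous_subtype_val.comp κ.symm.continuous⟩
  obtain ⟨f, g, df, sf, dg, sg, hfg, h1, h2, h3, h4, h5, h6⟩ := exists_smooth_pair (μ.map a)
    (ν.map b) (hcoer.comp_equiv ι.symm κ.symm) φ' ψ' (fun z w => h (ι.symm z) (κ.symm w)) hδ hε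
  have cf := df.continuous
  have cg := dg.continuous
  rw [integral_map ca.measurable.aemeasurable φ'.continuous.aestronglyMeasurable,
    integral_map cb.measurable.aemeasurable ψ'.continuous.aestronglyMeasurable,
    integral_map ca.measurable.aemeasurable cf.aestronglyMeasurable,
    integral_map cb.measurable.aemeasurable cg.aestronglyMeasurable] at h6
  obtain ⟨Cf, hCf⟩ := sf.exists_bound_of_continuous cf
  obtain ⟨Cg, hCg⟩ := sg.exists_bound_of_continuous cg
  have if' : Integrable (fun x => f (a x)) μ := by
    refine Integrable.of_bound (cf.comp ca).measurable.aestronglyMeasurable Cf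
      (Eventually.of_forall fun x => hCf _)
  have ig' : Integrable (fun y => g (b y)) ν := by
    refine Integrable.of_bound (cg.comp cb).measurable.aestronglyMeasurable Cg
      (Eventually.of_forall fun x => hCg _)
  refine ⟨(fun x => f (a x), fun y => g (b y)), ⟨⟨⟨if', ig', Set.univ, Set.univ, by simp, by simp,
    fun x _ y _ => ?_⟩, ⟨cf.comp ca, Cf, fun x => hCf _⟩, ⟨cg.comp cb, Cg, fun y => hCg _⟩,
    ?_, ?_, ?_, fun y => ?_, ?_⟩, ⟨ι, f, df, sf, fun x => rfl⟩, ⟨κ, g, dg, sg, fun y => rfl⟩⟩, ?_⟩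
  · refine coe_le_coe_of_ofReal_le ((hfg (a x) (b y)).trans ?_)
    simp only [restrictCost, hι, hκ]
    exact hle x y
  -- Since `a` and `b` are onto, composition with them preserves the suprema and infima in the
  -- relaxed bounds.
  · simpa only [sa.iInf_comp] using h1
  · simpa only [sa.iInf_comp] using h2
  · simp only [sa.iSup_comp]
    exact coe_le_coe_of_ofReal_le (h3.trans (iSup_le fun q =>
      le_iSup c ((ι.symm q.1 : X), (κ.symm q.2 : Y))))
  · simpa only [sa.iSup_comp] using h4 (b y)
  · simpa only [sb.iSup_comp] using h5
  · have e1 : ∀ x, φ' (a x) = φ (P x) := fun x => congrArg φ (hι x)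
    have e2 : ∀ y, ψ' (b y) = ψ (Q y) := fun y => congrArg ψ (hκ y)
    simpa only [e1, e2] using h6

end TopologicalVectorSpace

theorem tendsto_integral_comp {X : Type*} [TopologicalSpace X] [MeasurableSpace X]
    [OpensMeasurableSpace X] (μ : Measure X) [IsFiniteMeasure μ] {T : ℕ → X → X}
    (hT : ∀ k, Continuous (T k)) (hlim : ∀ x, Tendsto (fun k => T k x) atTop (𝓝 x))
    (φ : X →ᵇ ℝ) : Tendsto (fun k => ∫ x, φ (T k x) ∂μ) atTop (𝓝 (∫ x, φ x ∂μ)) :=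
  tendsto_integral_of_dominated_convergence (fun _ => ‖φ‖)
    (fun k => (φ.continuous.comp (hT k)).measurable.aestronglyMeasurable) (integrable_const _)
    (fun _ => Eventually.of_forall fun _ => φ.norm_coe_le_norm _)
    (Eventually.of_forall fun x => (φ.continuous.tendsto x).comp (hlim x))

end CylOT

/-! ### The duality formula -/

open CylOT BoundedContinuousFunction in
theorem theorem3
    {X : Type*} [AddCommGroup X] [Module ℝ X] [UniformSpace X] [IsUniformAddGroup X]
    [ContinuousSMul ℝ X] [LocallyConvexSpace ℝ X] [TopologicalSpace.MetrizableSpace X]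
    [CompleteSpace X] [MeasurableSpace X] [BorelSpace X]
    {Y : Type*} [AddCommGroup Y] [Module ℝ Y] [UniformSpace Y] [IsUniformAddGroup Y]
    [ContinuousSMul ℝ Y] [LocallyConvexSpace ℝ Y] [TopologicalSpace.MetrizableSpace Y]
    [CompleteSpace Y] [MeasurableSpace Y] [BorelSpace Y]
    (P : ℕ → X →L[ℝ] X) (Q : ℕ → Y →L[ℝ] Y)
    (hPfin : ∀ k, FiniteDimensional ℝ (LinearMap.range (P k).toLinearMap))
    (hQfin : ∀ k, FiniteDimensional ℝ (LinearMap.range (Q k).toLinearMap))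
    (hP : ∀ x, Tendsto (fun k => P k x) atTop (𝓝 x))
    (hQ : ∀ y, Tendsto (fun k => Q k y) atTop (𝓝 y))
    (c : X × Y → ℝ≥0∞) (hc : LowerSemicontinuous c)
    (hcoer : ∀ k, CylOT.LocallyCoercive (CylOT.restrictCost c (P k) (Q k)))
    (hle : ∀ k x y, c (P k x, Q k y) ≤ c (x, y))
    (μ : Measure X) [IsProbabilityMeasure μ] (ν : Measure Y) [IsProbabilityMeasure ν]
    (δ : ℝ) (hδ : 0 < δ) :
    (CylOT.transportCost c μ ν : EReal) =
      ⨆ k : ℕ, ⨆ p ∈ CylOT.relaxedDualPairs c μ ν δ ∩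
          (CylOT.cylindrical (P k) ×ˢ CylOT.cylindrical (Q k)),
        ((∫ x, p.1 x ∂μ + ∫ y, p.2 y ∂ν : ℝ) : EReal) := by
  -- A countably generated uniformity, completeness and separability make `X` and `Y` Polish.
  have : (uniformity X).IsCountablyGenerated := IsUniformAddGroup.uniformity_countably_generated
  have : (uniformity Y).IsCountablyGenerated := IsUniformAddGroup.uniformity_countably_generated
  have := separableSpace_of_tendsto_finiteRank P hPfin hP
  have := separableSpace_of_tendsto_finiteRank Q hQfin hQ
  refine le_antisymm ?_ (iSup_le fun k => iSup₂_le fun p hp => dual_le_transportCost hp.1.1)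
  set S : EReal := ⨆ k : ℕ, ⨆ p ∈ relaxedDualPairs c μ ν δ ∩
    (cylindrical (P k) ×ˢ cylindrical (Q k)),
      ((∫ x, p.1 x ∂μ + ∫ y, p.2 y ∂ν : ℝ) : EReal) with hS
  have key : ∀ (φ : X →ᵇ ℝ) (ψ : Y →ᵇ ℝ), (∀ x y, ENNReal.ofReal (φ x + ψ y) ≤ c (x, y)) →
      ∀ k, ∀ ε > 0, ((∫ x, φ (P k x) ∂μ + ∫ y, ψ (Q k y) ∂ν - ε : ℝ) : EReal) ≤ S := by
    intro φ ψ h k ε hε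
    have := hPfin k
    have := hQfin k
    obtain ⟨p, hp, hpε⟩ := exists_cylindrical_pair (P k) (Q k) (hcoer k) (hle k) μ ν φ ψ h hδ hε
    exact (EReal.coe_le_coe_iff.2 hpε).trans (le_iSup_of_le k (le_iSup₂_of_le p hp le_rfl))
  rcases eq_or_ne S ⊤ with htop | htop
  · rw [htop]; exact le_top
  -- The zero pair yields a cylindrical pair of value at least `-1`, so the supremum is not over an
  -- empty set.
  have hbot : S ≠ ⊥ := fun hb => by
    have := key 0 0 (by simp) 0 1 one_pos
    rw [hb] at this
    exact EReal.coe_ne_bot _ (le_bot_iff.1 this)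
  clear_value S
  lift S to ℝ using ⟨htop, hbot⟩
  have hD : ∀ (φ : X →ᵇ ℝ) (ψ : Y →ᵇ ℝ), (∀ x y, ENNReal.ofReal (φ x + ψ y) ≤ c (x, y)) →
      ∫ x, φ x ∂μ + ∫ y, ψ y ∂ν ≤ S := by
    intro φ ψ h
    refine le_of_tendsto' ((tendsto_integral_comp μ (fun k => (P k).continuous) hP φ).add
      (tendsto_integral_comp ν (fun k => (Q k).continuous) hQ ψ)) fun k => ?_
    refine le_of_forall_pos_le_add fun ε hε => ?_
    have := EReal.coe_le_coe_iff.1 (key φ ψ h k ε hε)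
    linarith
  have hS0 : 0 ≤ S := by simpa using hD 0 0 (by simp)
  obtain ⟨γ, hγ, hγc⟩ := exists_coupling_lintegral_le μ ν hc hD
  calc (transportCost c μ ν : EReal) ≤ (ENNReal.ofReal S : EReal) :=
        EReal.coe_ennreal_le_coe_ennreal_iff.2 ((iInf₂_le γ hγ).trans hγc)
    _ = S := by rw [EReal.coe_ennreal_ofReal, max_eq_left hS0]
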